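/- **Setting.** Let $(X,\mathsf d)$ be a complete separable metric space and $\mathfrak m$ a non-negative Borel-regular measure on $X$ with $\operatorname{supp}\mathfrak m=X$ such that, for some $A,B>0$ and $\bar x\in X$, $\mathfrak m(\{x:\mathsf d(x,\bar x)<r\})\le Ae^{Br^2}$ for all $r>0$. For $f\in \mathrm L^2(X,\mathfrak m)$ let $$\mathsf{Ch}(f)=\inf\Big\{\liminf_{k\to\infty}\tfrac12\int_X|\mathsf Df_k|^2\,d\mathfrak m:\ f_k \text{ Lipschitz with bounded support},\ f_k\to f\text{ in }\mathrm L^2\Big\}$$ be the Cheeger energy, where $|\mathsf Df|(x)=\limsup_{y\to x}\frac{|f(y)-f(x)|}{\mathsf d(y,x)}$ is the slope ($0$ at isolated points). Assume that $(X,\mathsf d,\mathfrak m)$ is infinitesimally Hilbertian: $2\mathsf{Ch}(f)+2\mathsf{Ch}(g)=\mathsf{Ch}(f+g)+\mathsf{Ch}(f-g)$ whenever $\mathsf{Ch}(f),\mathsf{Ch}(g)<\infty$. Let $\Delta f$ be the element of minimal $\mathrm L^2$ norm of $-\partial^-\mathsf{Ch}(f)$, for $f\in\mathrm{Dom}(\Delta)=\{f\in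 \mathrm L^2:\partial^-\mathsf{Ch}(f)\neq\emptyset\}$. Let $(\mathsf H_t)_{t\ge0}$ be the heat semigroup, i.e. the $\mathrm L^2$ gradient flow of $\mathsf{Ch}$, extended to $\mathrm L^1$ by density and to $\mathrm L^\infty$ by duality. A $\lambda$-eigenfunction is a non-zero $f_\lambda\in\mathrm{Dom}(\Delta)$ with $-\Delta f_\lambda=\lambda f_\lambda$. For non-negative Borel measures let $$\mathsf W_1(\mu,\nu)=\sup\Big\{\int_X\varphi\,d\mu-\int_X\varphi\,d\nu:\ \varphi\text{ bounded, }1\text{-Lipschitz, integrable with respect to }\mu\text{ and }\nu\Big\}\in[0,\infty]$$ (the integrability of $\varphi$ is automatic if $\mu,\nu$ are finite). Finally, let $\mathsf c:(0,\infty)\to(0,\infty)$ be such that, for every $f\in\mathrm L^\infty(X)$ and $t>0$, $\mathsf H_tf$ is bounded and Lipschitz with $\mathrm{Lip}(\mathsf H_tf)\le\mathsf c(t)\|f\|_{\mathrm L^\infty}$. **Theorem.** Let $M\in[0,\infty)$, $b\in(0,1)$ and $\tilde\lambda>0$. There is a constant $C=C(M,b,\tilde\lambda)>0$, depending only on $M$,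 $b$ and $\tilde\lambda$, such that for every space and function $\mathsf c$ as above with $\mathsf c(t)\le M t^{-b}$ for all $t\in(0,1]$, every $\lambda\ge\tilde\lambda$ and every $\lambda$-eigenfunction $f_\lambda$, $$\mathsf W_1(f_\lambda^+\mathfrak m,f_\lambda^-\mathfrak m)\ \ge\ \frac{C}{\lambda^{b}}\,\|f_\lambda\|_{\mathrm L^1(X)}.$$ In particular, for $b=\tfrac12$ the lower bound is $C\lambda^{-1/2}\|f_\lambda\|_{\mathrm L^1(X)}$, the lower bound in Steinerberger's conjecture. -/

import Mathlib

open MeasureTheory Filter Topology Set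
open scoped ENNReal NNReal

/-- The slope `|D f|(x) = limsup_{y → x, y ≠ x} |f y - f x| / d(y, x)`. At an isolated point the
punctured neighbourhood filter is `⊥`, so that the value there is `0`. -/
noncomputable def localSlope {X : Type*} [MetricSpace X] (f : X → ℝ) (x : X) : ℝ≥0∞ :=
  limsup (fun y => edist (f y) (f x) / edist y x) (𝓝[≠] x)

/-- `f ∈ Lip_bs(X)`: Lipschitz with bounded support. -/
def IsLipBs {X : Type*} [MetricSpace X] (f : X → ℝ) : Prop :=
  (∃ K : ℝ≥0, LipschitzWith K f) ∧ Bornology.IsBounded (tsupport f)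

/-- `f ∈ Lip_b(X)` with Lipschitz constant at most `K`. -/
def IsLipB {X : Type*} [MetricSpace X] (K : ℝ≥0) (f : X → ℝ) : Prop :=
  LipschitzWith K f ∧ ∃ B : ℝ, ∀ x, |f x| ≤ B

/-- The Cheeger energy of `f ∈ L²(X, m)`: the `L²`-relaxation of `½ ∫ |D f|² dm` from
`Lip_bs(X)`. -/
noncomputable def cheegerEnergy {X : Type*} [MetricSpace X] [MeasurableSpace X] (m : Measure X)
    (f : Lp ℝ 2 m) : ℝ≥0∞ :=
  ⨅ (F : ℕ → X → ℝ) (_ : ∀ k, IsLipBs (F k))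
    (_ : Tendsto (fun k => eLpNorm (fun x => F k x - f x) 2 m) atTop (𝓝 0)),
    liminf (fun k => (2 : ℝ≥0∞)⁻¹ * ∫⁻ x, localSlope (F k) x ^ 2 ∂m) atTop

/-- `(X, d, m)` is infinitesimally Hilbertian: the Cheeger energy satisfies the parallelogram
identity on `W^{1,2}(X) = {Ch < ∞}`. -/
def IsInfinitesimallyHilbertian {X : Type*} [MetricSpace X] [MeasurableSpace X]
    (m : Measure X) : Prop :=
  ∀ f g : Lp ℝ 2 m, cheegerEnergy m f < ⊤ → cheegerEnergy m g < ⊤ →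
    2 * cheegerEnergy m f + 2 * cheegerEnergy m g
      = cheegerEnergy m (f + g) + cheegerEnergy m (f - g)

/-- The subdifferential `∂⁻Ch(f) ⊆ L²(X, m)`: all `ℓ` with
`Ch(g) ≥ Ch(f) + ∫ ℓ (g - f) dm` for every `g ∈ L²`. -/
def cheegerSubdifferential {X : Type*} [MetricSpace X] [MeasurableSpace X] (m : Measure X)
    (f : Lp ℝ 2 m) : Set (Lp ℝ 2 m) :=
  {l | ∀ g : Lp ℝ 2 m,
    (cheegerEnergy m f : EReal) + ((inner ℝ l (g - f) : ℝ) : EReal) ≤ (cheegerEnergy m g : EReal)}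

/-- `f ∈ Dom(Δ)` and `Δ f = v`: `v` is the element of minimal norm of `-∂⁻Ch(f)`. -/
def IsLaplacian {X : Type*} [MetricSpace X] [MeasurableSpace X] (m : Measure X)
    (f v : Lp ℝ 2 m) : Prop :=
  -v ∈ cheegerSubdifferential m f ∧ ∀ l ∈ cheegerSubdifferential m f, ‖v‖ ≤ ‖l‖

/-- `f` is a `lam`-eigenfunction: a non-zero `f ∈ Dom(Δ)` with `-Δ f = lam f`. -/
def IsEigenfunction {X : Type*} [MetricSpace X] [MeasurableSpace X] (m : Measure X)
    (lam : ℝ) (f : Lp ℝ 2 m) : Prop :=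
  f ≠ 0 ∧ IsLaplacian m f (-(lam • f))

/-- `u` is the heat flow starting from `f`: a locally Lipschitz curve `(0, ∞) → L²(X, m)` with
`u'(t) = Δ u(t)` for a.e. `t > 0` and `u(t) → f` in `L²` as `t → 0⁺`. -/
def IsHeatFlow {X : Type*} [MetricSpace X] [MeasurableSpace X] (m : Measure X)
    (f : Lp ℝ 2 m) (u : ℝ → Lp ℝ 2 m) : Prop :=
  LocallyLipschitzOn (Ioi 0) u ∧
  (∀ᵐ t ∂(volume.restrict (Ioi (0 : ℝ))), ∃ v, IsLaplacian m (u t) v ∧ HasDerivAt u v t) ∧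
  Tendsto u (𝓝[>] 0) (𝓝 f)

/-- `H_t f = v` in `L²`, for `t > 0`. -/
def IsHeatL2 {X : Type*} [MetricSpace X] [MeasurableSpace X] (m : Measure X) (t : ℝ)
    (f v : Lp ℝ 2 m) : Prop :=
  ∃ u, IsHeatFlow m f u ∧ u t = v

/-- `H_t f = v` in `L¹`, where `H_t` is extended from `L¹ ∩ L²` to `L¹` by density. -/
def IsHeatL1 {X : Type*} [MetricSpace X] [MeasurableSpace X] (m : Measure X) (t : ℝ)
    (f v : Lp ℝ 1 m) : Prop :=
  ∃ F V : ℕ → Lp ℝ 2 m, (∀ n, IsHeatL2 m t (F n) (V n)) ∧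
    Tendsto (fun n => eLpNorm (fun x => F n x - f x) 1 m) atTop (𝓝 0) ∧
    Tendsto (fun n => eLpNorm (fun x => V n x - v x) 1 m) atTop (𝓝 0)

/-- `H_t f = g` (m-a.e.) for `f ∈ L^∞`, where `H_t` is extended to `L^∞` from `L² ∩ L^∞` by
duality with `L¹`: `∫ k (H_t f) dm = ∫ f (H_t k) dm` for all `k ∈ L¹`. -/
def IsHeatLinfty {X : Type*} [MetricSpace X] [MeasurableSpace X] (m : Measure X) (t : ℝ)
    (f g : X → ℝ) : Prop :=
  MemLp f ⊤ m ∧ MemLp g ⊤ m ∧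
  (∀ k v : Lp ℝ 1 m, IsHeatL1 m t k v → ∫ x, k x * g x ∂m = ∫ x, f x * v x ∂m) ∧
  (∀ f₂ : Lp ℝ 2 m, f₂ =ᵐ[m] f → ∃ v : Lp ℝ 2 m, IsHeatL2 m t f₂ v ∧ v =ᵐ[m] g)

/-- The `L^∞`-to-`Lip` contraction property with Lipschitz constant `c`: if `f ∈ L^∞(X)` then
`H_t f ∈ Lip_b(X)` with `Lip(H_t f) ≤ c(t) ‖f‖_∞` for all `t > 0`. -/
def LinftyToLip {X : Type*} [MetricSpace X] [MeasurableSpace X] (m : Measure X)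
    (c : ℝ → ℝ) : Prop :=
  ∀ f : X → ℝ, MemLp f ⊤ m → ∀ t : ℝ, 0 < t →
    ∃ g : X → ℝ, IsHeatLinfty m t f g ∧ IsLipB (Real.toNNReal (c t * (eLpNorm f ⊤ m).toReal)) g

/-- The volume growth condition `m(B_r(x₀)) ≤ A exp(B r²)` for all `r > 0`. -/
def HasGaussianGrowth {X : Type*} [MetricSpace X] [MeasurableSpace X] (m : Measure X) : Prop :=
  ∃ A B : ℝ, 0 < A ∧ 0 < B ∧ ∃ x₀ : X, ∀ r : ℝ, 0 < r →
    m (Metric.ball x₀ r) ≤ ENNReal.ofReal (A * Real.exp (B * r ^ 2))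

/-- The `1`-Wasserstein distance, in its dual form: the supremum of `∫ φ dμ - ∫ φ dν` over bounded
`1`-Lipschitz `φ`. The integrability of `φ` is automatic for finite measures; asking for it
extends the definition to all measures. The function `φ = 0` makes the supremum non-negative,
so that `ENNReal.ofReal` changes nothing. -/
noncomputable def wassersteinOne {X : Type*} [MetricSpace X] [MeasurableSpace X]
    (μ ν : Measure X) : ℝ≥0∞ :=
  ⨆ (φ : X → ℝ) (_ : IsLipB 1 φ) (_ : Integrable φ μ) (_ : Integrable φ ν),
    ENNReal.ofReal (∫ x, φ x ∂μ - ∫ x, φ x ∂ν)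

/-!
Let `f` be an eigenfunction with eigenvalue `lam`. By duality, `W₁(f⁺m, f⁻m)` is bounded below by
`∫ ψ f dm` for every bounded `1`-Lipschitz `ψ` with `ψ f` integrable. The test functions are
`ψ = H_t φ / c(t)`, where `φ` is the sign of `f` cut off to `{|f| ≥ 1 / (n + 1)}`. The cut-off makes
`φ` square integrable, so that `ψ f` is integrable even if `f ∉ L¹`. The assumed regularization of
the heat flow makes `ψ` admissible, and

`∫ f H_t φ dm = exp (-lam t) ∫ f φ dm = exp (-lam t) ∫_{|f| ≥ 1/(n+1)} |f| dm`.

As `n → ∞` this gives `W₁ ≥ exp (-lam t) / c(t) ‖f‖₁`, and the choice `t = min 1 lam₀ / lam ≤ 1`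
yields the bound.

The decay identity `⟪f, H_t φ⟫ = exp (-lam t) ⟪f, φ⟫` is obtained by integrating the scalar equation
`w' = -lam w` for `w(t) = ⟪f, H_t φ⟫`, which holds almost everywhere and suffices since `w` is locally
Lipschitz (`eq_exp_mul_of_ae_hasDerivAt`). The equation itself is the symmetry of the Laplacian
(`IsLaplacian.inner_comm`): under the parallelogram identity a subgradient `l` of the Cheeger energy
`Ch` at `u` satisfies the exact expansion `Ch(u + f) = Ch(u) + ⟪l, f⟫ + Ch(f)`
(`toReal_add_eq_of_parallelogram`), and exchanging `u` and `f` identifies the two linear terms.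
-/

/-! ### Subgradients of quadratic functionals -/

/-- The error `q(u + x) - q(u) - ⟪l, x⟫ - q(x)` in the first order expansion is bounded by `q(x)`, it
doubles when `x` does, and `q(x)` quadruples; comparing the scales `x` and `x / 2 ^ n` bounds the
error by `q(x) / 2 ^ n`. -/
theorem abs_sub_le_of_parallelogram {E : Type*} [NormedAddCommGroup E] [InnerProductSpace ℝ E]
    {q : E → ℝ≥0∞}
    (hpar : ∀ f g, q f < ⊤ → q g < ⊤ → 2 * q f + 2 * q g = q (f + g) + q (f - g))
    (h0 : q 0 = 0) (hhalf : ∀ x, q x < ⊤ → q ((1 / 2 : ℝ) • x) < ⊤) {u l : E} (hu : q u < ⊤)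
    (hl : ∀ y, q y < ⊤ → (q u).toReal + inner ℝ l (y - u) ≤ (q y).toReal) (n : ℕ) :
    ∀ x, q x < ⊤ →
      |(q (u + x)).toReal - (q u).toReal - inner ℝ l x - (q x).toReal| ≤ (q x).toReal / 2 ^ n := by
  have hfin : ∀ f g, q f < ⊤ → q g < ⊤ → q (f + g) < ⊤ ∧ q (f - g) < ⊤ := by
    intro f g hf hg
    rw [← ENNReal.add_lt_top, ← hpar f g hf hg]
    exact ENNReal.add_lt_top.2
      ⟨ENNReal.mul_lt_top (by simp) hf, ENNReal.mul_lt_top (by simp) hg⟩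
  have hparR : ∀ f g, q f < ⊤ → q g < ⊤ →
      2 * (q f).toReal + 2 * (q g).toReal = (q (f + g)).toReal + (q (f - g)).toReal := by
    intro f g hf hg
    have h := congrArg ENNReal.toReal (hpar f g hf hg)
    rw [ENNReal.toReal_add (ENNReal.mul_lt_top (by simp) hf).ne
      (ENNReal.mul_lt_top (by simp) hg).ne, ENNReal.toReal_add (hfin f g hf hg).1.ne
      (hfin f g hf hg).2.ne] at h
    simpa using h
  induction n with
  | zero =>
    intro x hx
    have h1 := hl _ (hfin u x hu hx).1
    have h2 := hl _ (hfin u x hu hx).2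
    have h3 := hparR u x hu hx
    rw [add_sub_cancel_left] at h1
    rw [sub_sub_cancel_left, inner_neg_right] at h2
    rw [pow_zero, div_one, abs_le]
    constructor <;> linarith
  | succ n ih =>
    intro x hx
    obtain ⟨y, hy, rfl⟩ : ∃ y, q y < ⊤ ∧ x = y + y :=
      ⟨(1 / 2 : ℝ) • x, hhalf x hx, by rw [← add_smul]; norm_num⟩
    have h1 := hparR y y hy hy
    have h2 := hparR (u + y) y (hfin u y hu hy).1 hy
    rw [sub_self, h0, ENNReal.toReal_zero, add_zero] at h1
    rw [add_sub_cancel_right, add_assoc] at h2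
    have h3 := ih y hy
    have e1 : (q (u + (y + y))).toReal - (q u).toReal - inner ℝ l (y + y) - (q (y + y)).toReal
        = 2 * ((q (u + y)).toReal - (q u).toReal - inner ℝ l y - (q y).toReal) := by
      rw [inner_add_right]; linarith
    have e2 : (q (y + y)).toReal / 2 ^ (n + 1) = 2 * ((q y).toReal / 2 ^ n) := by
      rw [← h1, pow_succ]; field_simp; ring
    rw [e1, e2, abs_mul, abs_two]
    linarith

/-- If `q` satisfies the parallelogram identity on its domain, then its first order expansion at `u`
with a subgradient `l` is exact, with remainder `q`. -/
theorem toReal_add_eq_of_parallelogram {E : Type*} [NormedAddCommGroup E] [InnerProductSpace ℝ E]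
    {q : E → ℝ≥0∞}
    (hpar : ∀ f g, q f < ⊤ → q g < ⊤ → 2 * q f + 2 * q g = q (f + g) + q (f - g))
    (h0 : q 0 = 0) (hhalf : ∀ x, q x < ⊤ → q ((1 / 2 : ℝ) • x) < ⊤) {u l : E} (hu : q u < ⊤)
    (hl : ∀ y, q y < ⊤ → (q u).toReal + inner ℝ l (y - u) ≤ (q y).toReal) {x : E}
    (hx : q x < ⊤) :
    (q (u + x)).toReal = (q u).toReal + inner ℝ l x + (q x).toReal := by
  have hlim : Tendsto (fun n : ℕ => (q x).toReal / 2 ^ n) atTop (𝓝 0) := by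
    simpa [div_eq_mul_inv] using
      (tendsto_pow_atTop_nhds_zero_of_lt_one (r := (2 : ℝ)⁻¹) (by norm_num)
        (by norm_num)).const_mul (q x).toReal
  have h := ge_of_tendsto' hlim
    fun n => abs_sub_le_of_parallelogram hpar h0 hhalf hu hl n x hx
  have h' := abs_eq_zero.1 (le_antisymm h (abs_nonneg _))
  linarith

/-! ### The Cheeger energy and the symmetry of the Laplacian -/

section Cheeger

variable {X : Type*} [MetricSpace X]

theorem localSlope_const_mul_le {c : ℝ} (hc : |c| ≤ 1) (f : X → ℝ) (x : X) :
    localSlope (fun y => c * f y) x ≤ localSlope f x := by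
  refine limsup_le_limsup (Eventually.of_forall fun y => ?_)
  refine ENNReal.div_le_div_right ?_ _
  rw [edist_dist, edist_dist]
  refine ENNReal.ofReal_le_ofReal ?_
  rw [Real.dist_eq, Real.dist_eq, ← mul_sub, abs_mul]
  exact mul_le_of_le_one_left (abs_nonneg _) hc

theorem IsLipBs.const_mul {f : X → ℝ} (hf : IsLipBs f) {c : ℝ} (hc : |c| ≤ 1) :
    IsLipBs fun x => c * f x := by
  obtain ⟨⟨K, hK⟩, hb⟩ := hf
  refine ⟨⟨K, LipschitzWith.of_dist_le_mul fun x y => le_trans ?_ (hK.dist_le_mul x y)⟩,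
    hb.subset (closure_mono fun x hx => ?_)⟩
  · rw [Real.dist_eq, Real.dist_eq, ← mul_sub, abs_mul]
    exact mul_le_of_le_one_left (abs_nonneg _) hc
  · exact right_ne_zero_of_mul hx

variable [MeasurableSpace X] {m : Measure X}

theorem cheegerEnergy_zero : cheegerEnergy m 0 = 0 := by
  refine le_antisymm ?_ zero_le
  have hlip : ∀ _ : ℕ, IsLipBs fun _ : X => (0 : ℝ) := fun _ =>
    ⟨⟨0, LipschitzWith.const 0⟩, by simp [tsupport]⟩
  have hlim : Tendsto (fun _ : ℕ => eLpNorm (fun x => (0 : ℝ) - (0 : Lp ℝ 2 m) x) 2 m) atTop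
      (𝓝 0) := by
    have : eLpNorm (fun x => (0 : ℝ) - (0 : Lp ℝ 2 m) x) 2 m = 0 := by
      rw [eLpNorm_congr_ae (g := fun _ => (0 : ℝ)), eLpNorm_zero']
      filter_upwards [Lp.coeFn_zero ℝ 2 m] with x hx
      rw [hx, Pi.zero_apply, sub_zero]
    rw [this]
    exact tendsto_const_nhds
  refine (iInf_le_of_le (fun _ _ => 0) (iInf_le_of_le hlip (iInf_le_of_le hlim le_rfl))).trans ?_
  have hs : ∀ x : X, localSlope (fun _ : X => (0 : ℝ)) x = 0 := fun x => by
    simp only [localSlope, edist_self, ENNReal.zero_div]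
    exact limsup_const_bot
  simp [hs]

theorem cheegerEnergy_smul_le {c : ℝ} (hc : |c| ≤ 1) (f : Lp ℝ 2 m) :
    cheegerEnergy m (c • f) ≤ cheegerEnergy m f := by
  refine le_iInf fun F => le_iInf fun hF => le_iInf fun hlim => ?_
  have hlim' : Tendsto (fun k => eLpNorm (fun x => c * F k x - (c • f) x) 2 m) atTop (𝓝 0) := by
    refine tendsto_of_tendsto_of_tendsto_of_le_of_le tendsto_const_nhds hlim
      (fun _ => zero_le) fun k => eLpNorm_mono_ae ?_
    filter_upwards [Lp.coeFn_smul c f] with x hx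
    rw [hx, Pi.smul_apply, smul_eq_mul, ← mul_sub, norm_mul]
    exact mul_le_of_le_one_left (norm_nonneg _) hc
  refine iInf_le_of_le (fun k x => c * F k x)
    (iInf_le_of_le (fun k => (hF k).const_mul hc) (iInf_le_of_le hlim' ?_))
  refine liminf_le_liminf (Eventually.of_forall fun k => ?_)
  gcongr with x
  exact localSlope_const_mul_le hc _ _

/-- A point at which the Cheeger energy has a subgradient has finite energy. -/
theorem cheegerEnergy_lt_top_of_mem_subdifferential {f l : Lp ℝ 2 m}
    (h : l ∈ cheegerSubdifferential m f) : cheegerEnergy m f < ⊤ := by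
  by_contra htop
  rw [not_lt, top_le_iff] at htop
  have h' := h 0
  rw [htop, cheegerEnergy_zero, EReal.coe_ennreal_top, EReal.top_add_coe] at h'
  simp at h'

theorem toReal_cheegerEnergy_add_le {f l g : Lp ℝ 2 m} (h : l ∈ cheegerSubdifferential m f)
    (hg : cheegerEnergy m g < ⊤) :
    (cheegerEnergy m f).toReal + inner ℝ l (g - f) ≤ (cheegerEnergy m g).toReal := by
  have hf := cheegerEnergy_lt_top_of_mem_subdifferential h
  have h' := h g
  rw [← EReal.coe_toReal (x := (cheegerEnergy m f : EReal)) (by simpa using hf.ne) (by simp),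
    ← EReal.coe_toReal (x := (cheegerEnergy m g : EReal)) (by simpa using hg.ne) (by simp)] at h'
  rw [← EReal.coe_add, EReal.coe_le_coe_iff] at h'
  simpa using h'

/-- The Laplacian of an infinitesimally Hilbertian space is symmetric. -/
theorem IsLaplacian.inner_comm (hH : IsInfinitesimallyHilbertian m) {u v f w : Lp ℝ 2 m}
    (hu : IsLaplacian m u v) (hf : IsLaplacian m f w) :
    (inner ℝ f v : ℝ) = inner ℝ w u := by
  have hhalf : ∀ x, cheegerEnergy m x < ⊤ → cheegerEnergy m ((1 / 2 : ℝ) • x) < ⊤ :=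
    fun x hx => (cheegerEnergy_smul_le (by norm_num) x).trans_lt hx
  have hu' := cheegerEnergy_lt_top_of_mem_subdifferential hu.1
  have hf' := cheegerEnergy_lt_top_of_mem_subdifferential hf.1
  have h1 := toReal_add_eq_of_parallelogram hH cheegerEnergy_zero hhalf hu'
    (fun y => toReal_cheegerEnergy_add_le hu.1) hf'
  have h2 := toReal_add_eq_of_parallelogram hH cheegerEnergy_zero hhalf hf'
    (fun y => toReal_cheegerEnergy_add_le hf.1) hu'
  rw [add_comm f u] at h2
  rw [inner_neg_left] at h1 h2
  rw [real_inner_comm]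
  linarith

end Cheeger

/-! ### Decay of an eigenfunction along the heat flow -/

theorem eq_exp_mul_of_ae_hasDerivAt {w : ℝ → ℝ} {lam w₀ : ℝ} (hw : LocallyLipschitzOn (Ioi 0) w)
    (hd : ∀ᵐ s ∂(volume.restrict (Ioi (0 : ℝ))), HasDerivAt w (-(lam * w s)) s)
    (h0 : Tendsto w (𝓝[>] 0) (𝓝 w₀)) {t : ℝ} (ht : 0 < t) :
    w t = Real.exp (-(lam * t)) * w₀ := by
  have hconst : ∀ s, 0 < s → s ≤ t → Real.exp (lam * s) * w s = Real.exp (lam * t) * w t := by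
    intro s hs hst
    have hsub : uIcc s t ⊆ Ioi 0 := by
      rw [uIcc_of_le hst]
      exact fun x hx => hs.trans_le hx.1
    obtain ⟨K, hK⟩ := (hw.mono hsub).exists_lipschitzOnWith_of_compact isCompact_uIcc
    have hexp : ContDiffOn ℝ 1 (fun s => Real.exp (lam * s)) (uIcc s t) := by fun_prop
    have hac : AbsolutelyContinuousOnInterval ((fun s => Real.exp (lam * s)) * w) s t :=
      hexp.absolutelyContinuousOnInterval.mul hK.absolutelyContinuousOnInterval
    obtain ⟨C, hC⟩ := hac.const_of_ae_hasDerivAt_zero (by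
      rw [ae_restrict_iff' measurableSet_Ioi] at hd
      filter_upwards [hd] with x hx hxm
      have he : HasDerivAt (fun s => Real.exp (lam * s)) (Real.exp (lam * x) * lam) x := by
        simpa using ((hasDerivAt_id x).const_mul lam).exp
      convert! he.mul (hx (hsub hxm)) using 1
      ring)
    exact (hC s left_mem_uIcc).trans (hC t right_mem_uIcc).symm
  have hlim : Tendsto (fun s => Real.exp (lam * s) * w s) (𝓝[>] 0) (𝓝 (1 * w₀)) := by
    refine Tendsto.mul (Tendsto.mono_left ?_ nhdsWithin_le_nhds) h0
    exact Continuous.tendsto' (by fun_prop) _ _ (by simp)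
  have hlim' : Tendsto (fun s => Real.exp (lam * s) * w s) (𝓝[>] 0)
      (𝓝 (Real.exp (lam * t) * w t)) := by
    refine tendsto_const_nhds.congr' ?_
    filter_upwards [Ioc_mem_nhdsGT ht] with s hs
    exact (hconst s hs.1 hs.2).symm
  rw [← one_mul w₀, tendsto_nhds_unique hlim hlim', ← mul_assoc, ← Real.exp_add]
  simp

theorem IsEigenfunction.inner_heat {X : Type*} [MetricSpace X] [MeasurableSpace X] {m : Measure X}
    (hH : IsInfinitesimallyHilbertian m) {lam t : ℝ} {f g v : Lp ℝ 2 m}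
    (hf : IsEigenfunction m lam f) (ht : 0 < t) (hv : IsHeatL2 m t g v) :
    (inner ℝ f v : ℝ) = Real.exp (-(lam * t)) * inner ℝ f g := by
  obtain ⟨u, ⟨hlip, hder, h0⟩, rfl⟩ := hv
  refine eq_exp_mul_of_ae_hasDerivAt (w := fun s => inner ℝ f (u s)) ?_ ?_ ?_ ht
  · intro x hx
    obtain ⟨K, s, hs, hK⟩ := hlip hx
    exact ⟨_, s, hs, (innerSL ℝ f).lipschitz.comp_lipschitzOnWith hK⟩
  · filter_upwards [hder] with s hs
    obtain ⟨v, hv, hd⟩ := hs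
    have h := (innerSL ℝ f).hasFDerivAt.comp_hasDerivAt s hd
    have e : (inner ℝ f v : ℝ) = -(lam * inner ℝ f (u s)) := by
      rw [hv.inner_comm hH hf.2, inner_neg_left, real_inner_smul_left]
    simpa [Function.comp_def, e] using h
  · exact tendsto_const_nhds.inner h0

/-! ### The lower bound for the Wasserstein distance -/

theorem iSup_setLIntegral_enorm_ge {X : Type*} [MeasurableSpace X] {m : Measure X}
    (f : X → ℝ) :
    ⨆ n : ℕ, ∫⁻ x in {x | ((n : ℝ≥0∞) + 1)⁻¹ ≤ ‖f x‖ₑ}, ‖f x‖ₑ ∂m = eLpNorm f 1 m := by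
  rw [← setLIntegral_iUnion_of_directed, eLpNorm_one_eq_lintegral_enorm]
  · refine setLIntegral_eq_of_support_subset fun x hx => ?_
    obtain ⟨n, hn⟩ := ENNReal.exists_inv_nat_lt (Function.mem_support.1 hx)
    refine mem_iUnion.2 ⟨n, le_trans ?_ hn.le⟩
    exact ENNReal.inv_le_inv.2 le_self_add
  · refine Monotone.directed_le fun a b hab x hx => ?_
    refine le_trans (ENNReal.inv_le_inv.2 ?_) (mem_ofPred_eq ▸ hx)
    gcongr

section Wasserstein

variable {X : Type*} [MetricSpace X] [MeasurableSpace X] {m : Measure X}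

theorem ofReal_integral_mul_le_wassersteinOne {f φ : X → ℝ} (hf : Measurable f)
    (hφ : IsLipB 1 φ) (hφm : AEStronglyMeasurable φ m) (hint : Integrable (fun x => f x * φ x) m) :
    ENNReal.ofReal (∫ x, f x * φ x ∂m)
      ≤ wassersteinOne (m.withDensity fun x => ENNReal.ofReal (f x))
          (m.withDensity fun x => ENNReal.ofReal (-f x)) := by
  have key : ∀ g : X → ℝ, Measurable g → (∀ x, |g x| = |f x|) →
      Integrable (fun x => (ENNReal.ofReal (g x)).toReal • φ x) m := by
    intro g hg hgf
    refine hint.mono ((by fun_prop : Measurable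
      fun x => (ENNReal.ofReal (g x)).toReal).aestronglyMeasurable.smul hφm)
      (Eventually.of_forall fun x => ?_)
    rw [norm_smul, norm_mul]
    refine mul_le_mul_of_nonneg_right ?_ (norm_nonneg _)
    rw [Real.norm_eq_abs, Real.norm_eq_abs, ← hgf, ENNReal.toReal_ofReal', abs_of_nonneg
      (le_max_right _ _)]
    exact max_le (le_abs_self _) (abs_nonneg _)
  have h1 := key f hf fun _ => rfl
  have h2 := key (fun x => -f x) hf.neg fun _ => abs_neg _
  have hm1 : Measurable fun x => ENNReal.ofReal (f x) := by fun_prop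
  have hm2 : Measurable fun x => ENNReal.ofReal (-f x) := by fun_prop
  have hfin : ∀ g : X → ℝ, ∀ᵐ x ∂m, ENNReal.ofReal (g x) < ⊤ := fun g => by simp
  refine le_iSup_of_le φ (le_iSup_of_le hφ (le_iSup_of_le
    ((integrable_withDensity_iff_integrable_smul' hm1 (hfin _)).2 h1) (le_iSup_of_le
    ((integrable_withDensity_iff_integrable_smul' hm2 (hfin _)).2 h2) (le_of_eq ?_))))
  rw [integral_withDensity_eq_integral_toReal_smul hm1 (hfin _),
    integral_withDensity_eq_integral_toReal_smul hm2 (hfin _), ← integral_sub h1 h2]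
  congr 2
  funext x
  rw [ENNReal.toReal_ofReal', ENNReal.toReal_ofReal', ← sub_smul, smul_eq_mul,
    max_zero_sub_max_neg_zero_eq_self]

/-- Duality applied to the test function `H_t φ / c(t)`, where `φ` is the sign of `f` on
`{|f| ≥ ε}` and `0` elsewhere. -/
theorem IsEigenfunction.setLIntegral_le_wassersteinOne [BorelSpace X]
    (hH : IsInfinitesimallyHilbertian m) {c : ℝ → ℝ} (hc : LinftyToLip m c) {lam t : ℝ}
    {f : Lp ℝ 2 m} (hf : IsEigenfunction m lam f) (ht : 0 < t) (hct : 0 < c t) {ε : ℝ≥0∞}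
    (hε : ε ≠ 0) :
    ENNReal.ofReal (Real.exp (-(lam * t)) / c t) * ∫⁻ x in {x | ε ≤ ‖f x‖ₑ}, ‖f x‖ₑ ∂m
      ≤ wassersteinOne (m.withDensity fun x => ENNReal.ofReal (f x))
          (m.withDensity fun x => ENNReal.ofReal (-f x)) := by
  have hfm : Measurable (f : X → ℝ) := (Lp.stronglyMeasurable f).measurable
  set S : Set X := {x | ε ≤ ‖f x‖ₑ}
  have hSm : MeasurableSet S := measurableSet_le measurable_const hfm.enorm
  have hSfin : m S < ⊤ := (Lp.memLp f).meas_ge_lt_top'_enorm (by simp) (by simp) hε (by simp)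
  -- `f / |f|` is the sign of `f`, also where `f = 0`, since `0 / 0 = 0`.
  set φ : X → ℝ := S.indicator fun x => f x / |f x| with hφ
  have hφm : Measurable φ := (hfm.div (by fun_prop)).indicator hSm
  have hφ1 : ∀ x, ‖φ x‖ ≤ 1 := fun x => by
    refine (norm_indicator_le_norm_self _ _).trans ?_
    rw [norm_div, Real.norm_eq_abs, Real.norm_eq_abs, abs_abs]
    exact div_self_le_one _
  have hφtop : MemLp φ ⊤ m := memLp_top_of_bound hφm.aestronglyMeasurable 1 (.of_forall hφ1)
  have hφ2 : MemLp φ 2 m := by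
    refine (memLp_indicator_const 2 hSm (1 : ℝ) (.inr hSfin.ne)).mono hφm.aestronglyMeasurable
      (.of_forall fun x => ?_)
    by_cases hx : x ∈ S
    · rw [indicator_of_mem hx, norm_one]
      exact hφ1 x
    · rw [hφ, indicator_of_notMem hx, norm_zero]
      exact norm_nonneg _
  have hfφ : ∀ x, f x * φ x = S.indicator (fun x => |f x|) x := fun x => by
    by_cases hx : x ∈ S
    · rw [hφ, indicator_of_mem hx, indicator_of_mem hx, mul_div_assoc', ← abs_mul_abs_self,
        mul_self_div_self]
    · rw [hφ, indicator_of_notMem hx, indicator_of_notMem hx, mul_zero]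
  obtain ⟨g, ⟨-, -, -, hg2⟩, hgL, B, hgB⟩ := hc φ hφtop t ht
  obtain ⟨v, hv, hvg⟩ := hg2 (hφ2.toLp φ) hφ2.coeFn_toLp
  have hinner := hf.inner_heat hH ht hv
  have hmul : ∀ a b : ℝ, inner ℝ a b = a * b := fun a b => by simp [mul_comm]
  simp only [L2.inner_def, hmul] at hinner
  rw [integral_congr_ae (g := fun x => f x * g x) (by filter_upwards [hvg] with x hx; rw [hx]),
    integral_congr_ae (f := fun x => f x * hφ2.toLp φ x) (g := fun x => f x * φ x)
      (by filter_upwards [hφ2.coeFn_toLp] with x hx; rw [hx])] at hinner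
  have hgf : Integrable (fun x => f x * g x) m :=
    (Lp.memLp f).integrable_mul ((memLp_congr_ae hvg).1 (Lp.memLp v))
  have hlip : IsLipB 1 fun x => (c t)⁻¹ * g x := by
    refine ⟨LipschitzWith.of_dist_le_mul fun x y => ?_, (c t)⁻¹ * B, fun x => ?_⟩
    · have hnorm : c t * (eLpNorm φ ⊤ m).toReal ≤ c t := by
        refine mul_le_of_le_one_right hct.le (ENNReal.toReal_le_of_le_ofReal zero_le_one ?_)
        rw [eLpNorm_exponent_top]
        exact eLpNormEssSup_le_of_ae_bound (.of_forall hφ1)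
      have h := hgL.dist_le_mul x y
      rw [Real.coe_toNNReal _ (by positivity)] at h
      rw [Real.dist_eq, ← mul_sub, abs_mul, abs_of_pos (inv_pos.2 hct), NNReal.coe_one, one_mul,
        inv_mul_le_iff₀ hct]
      exact h.trans (mul_le_mul_of_nonneg_right hnorm dist_nonneg)
    · rw [abs_mul, abs_of_pos (inv_pos.2 hct)]
      exact mul_le_mul_of_nonneg_left (hgB x) (inv_pos.2 hct).le
  have e1 : ∀ x, f x * ((c t)⁻¹ * g x) = (c t)⁻¹ * (f x * g x) := fun x => mul_left_comm _ _ _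
  have hmain := ofReal_integral_mul_le_wassersteinOne (m := m) hfm hlip
    (hlip.1.continuous.measurable.aestronglyMeasurable)
    ((hgf.const_mul (c t)⁻¹).congr (.of_forall fun x => (e1 x).symm))
  simp only [e1] at hmain
  refine le_trans (le_of_eq ?_) hmain
  rw [integral_const_mul, hinner, ← mul_assoc, ← div_eq_inv_mul,
    ENNReal.ofReal_mul (div_nonneg (Real.exp_pos _).le hct.le),
    ofReal_integral_eq_lintegral_ofReal (f := fun x => f x * φ x)
      ((Lp.memLp f).integrable_mul hφ2)
      (.of_forall fun x => (indicator_nonneg (fun _ _ => abs_nonneg _) x).trans_eq (hfφ x).symm),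
    ← lintegral_indicator hSm]
  congr 2
  funext x
  rw [hfφ]
  by_cases hx : x ∈ S
  · rw [indicator_of_mem hx, indicator_of_mem hx, ← Real.norm_eq_abs, ofReal_norm]
  · rw [indicator_of_notMem hx, indicator_of_notMem hx, ENNReal.ofReal_zero]

theorem IsEigenfunction.eLpNorm_one_le_wassersteinOne [BorelSpace X]
    (hH : IsInfinitesimallyHilbertian m) {c : ℝ → ℝ} (hc : LinftyToLip m c) {lam t : ℝ}
    {f : Lp ℝ 2 m} (hf : IsEigenfunction m lam f) (ht : 0 < t) (hct : 0 < c t) :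
    ENNReal.ofReal (Real.exp (-(lam * t)) / c t) * eLpNorm f 1 m
      ≤ wassersteinOne (m.withDensity fun x => ENNReal.ofReal (f x))
          (m.withDensity fun x => ENNReal.ofReal (-f x)) := by
  rw [← iSup_setLIntegral_enorm_ge, ENNReal.mul_iSup]
  exact iSup_le fun n => hf.setLIntegral_le_wassersteinOne hH hc ht hct (by simp)

end Wasserstein

theorem mainTheorem4 (M b lam₀ : ℝ) (hM : 0 ≤ M) (hb₀ : 0 < b) (hb₁ : b < 1) (hlam₀ : 0 < lam₀) :
    ∃ C : ℝ, 0 < C ∧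
      ∀ (X : Type*) [MetricSpace X] [CompleteSpace X] [TopologicalSpace.SeparableSpace X]
        [MeasurableSpace X] [BorelSpace X] (m : Measure X) [m.IsOpenPosMeasure],
        HasGaussianGrowth m → IsInfinitesimallyHilbertian m →
        ∀ c : ℝ → ℝ, (∀ t, 0 < t → 0 < c t) → LinftyToLip m c →
          (∀ t, 0 < t → t ≤ 1 → c t ≤ M / t ^ b) →
          ∀ (lam : ℝ) (f : Lp ℝ 2 m), lam₀ ≤ lam → IsEigenfunction m lam f →
            ENNReal.ofReal (C / lam ^ b) * eLpNorm f 1 m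
              ≤ wassersteinOne (m.withDensity fun x => ENNReal.ofReal (f x))
                  (m.withDensity fun x => ENNReal.ofReal (-f x)) := by
  -- The time is `s / lam`; the factor `s ≤ lam₀` keeps it in `(0, 1]`. The denominator `M + 1`
  -- makes the constant positive also for `M = 0`.
  set s := min 1 lam₀
  have hs0 : 0 < s := lt_min one_pos hlam₀
  refine ⟨Real.exp (-s) * s ^ b / (M + 1), by positivity, ?_⟩
  intro X _ _ _ _ _ m _ _ hH c hc0 hc hcM lam f hlam hf
  have hlam0 : 0 < lam := hlam₀.trans_le hlam
  have ht : 0 < s / lam := div_pos hs0 hlam0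
  have hct := hc0 _ ht
  refine le_trans ?_ (hf.eLpNorm_one_le_wassersteinOne hH hc ht hct)
  gcongr ENNReal.ofReal ?_ * _
  have hcle : c (s / lam) ≤ (M + 1) / (s / lam) ^ b := by
    refine (hcM _ ht ((div_le_one hlam0).2 ((min_le_right _ _).trans hlam))).trans ?_
    gcongr
    linarith
  calc Real.exp (-s) * s ^ b / (M + 1) / lam ^ b
      = Real.exp (-s) / ((M + 1) / (s / lam) ^ b) := by
        rw [Real.div_rpow hs0.le hlam0.le]
        have := Real.rpow_pos_of_pos hs0 b
        have := Real.rpow_pos_of_pos hlam0 b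
        field_simp
    _ ≤ Real.exp (-s) / c (s / lam) := by gcongr
    _ = Real.exp (-(lam * (s / lam))) / c (s / lam) := by rw [mul_div_cancel₀ _ hlam0.ne']
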